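/- Let $q,k_1,u_0,u_1\in\mathbb C^\star$ with $q^m\neq 1$ for all integers $m>0$, and fix a square root $q^{1/2}$ of $q$. Let $\mathcal H_{III}$ be the unital associative $\mathbb C$-algebra generated by $V_0,V_1,\check V_0,\check V_1$ with relations $$V_0^2=0,\quad (V_1-k_1)(V_1+k_1^{-1})=0,\quad \check V_0^2+u_0^{-1}\check V_0=0,\quad (\check V_1-u_1)(\check V_1+u_1^{-1})=0,$$ $$q^{1/2}\check V_1V_1V_0=\check V_0+u_0^{-1},\qquad q^{1/2}\check V_0\check V_1V_1=V_0 .$$ Let $\mathbb T_q$ be the quantum torus: the unital associative $\mathbb C$-algebra generated by the symbols $e^{aS_1+bS_2+cS_3}$, $(a,b,c)\in\mathbb Z^3$, subject to $e^0=1$, to the product rule $e^Ae^B=e^{[A,B]/2}e^{A+B}$, where $[S_1,S_2]=[S_2,S_3]=[S_3,S_1]=i\pi\hbar$ with $q^{1/2}=e^{-i\pi\hbar/2}$ (so, for example, $e^{S_1}e^{S_2}=q^{-1/2}e^{S_1+S_2}$), and to $-i\,e^{-S_1-S_2-S_3}=u_0$. Consider the assignment $$V_0\mapsto\begin{pmatrix}0&0\\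 i e^{S_3}&0\end{pmatrix},\qquad V_1\mapsto\begin{pmatrix}k_1-k_1^{-1}-ie^{S_2}&k_1-k_1^{-1}-ie^{-S_2}-ie^{S_2}\\ ie^{S_2}&ie^{S_2}\end{pmatrix},$$ $$\check V_1\mapsto\begin{pmatrix}0&-ie^{S_1}\\ ie^{-S_1}&u_1-u_1^{-1}\end{pmatrix},\qquad \check V_0\mapsto\begin{pmatrix}0&0\\ q^{1/2}s&-\frac1{u_0}\end{pmatrix},$$ where $$s=\Big(\tfrac1{k_1}-k_1\Big)e^{-S_1}e^{S_3}+\Big(\tfrac1{u_1}-u_1\Big)e^{S_2}e^{S_3}+i\,e^{-S_1}e^{-S_2}e^{S_3}+i\,e^{-S_1}e^{S_2}e^{S_3}.$$ Then these four matrices satisfy the six defining relations of $\mathcal H_{III}$ in $Mat(2,\mathbb T_q)$, and the assignment extends to an injective homomorphism of unital $\mathbb C$-algebras $\mathcal H_{III}\to Mat(2,\mathbb T_q)$. -/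

import Mathlib

/-- The four generators of the confluent Cherednik algebra `H_III`;
`V0c` and `V1c` stand for `V̌₀` and `V̌₁`. -/
inductive HIIIGen : Type
  | V0 | V1 | V0c | V1c

open HIIIGen in
/-- The defining relations of `H_III`, inside the free algebra on the four generators.
The parameter `r` is the chosen square root `q^{1/2}`. -/
inductive HIIIRel (r k₁ u₀ u₁ : ℂ) :
    FreeAlgebra ℂ HIIIGen → FreeAlgebra ℂ HIIIGen → Prop
  | sq_V0 : HIIIRel r k₁ u₀ u₁ (FreeAlgebra.ι ℂ V0 ^ 2) 0
  | quad_V1 : HIIIRel r k₁ u₀ u₁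
      ((FreeAlgebra.ι ℂ V1 - algebraMap ℂ _ k₁) * (FreeAlgebra.ι ℂ V1 + algebraMap ℂ _ k₁⁻¹)) 0
  | quad_V0c : HIIIRel r k₁ u₀ u₁
      (FreeAlgebra.ι ℂ V0c ^ 2 + u₀⁻¹ • FreeAlgebra.ι ℂ V0c) 0
  | quad_V1c : HIIIRel r k₁ u₀ u₁
      ((FreeAlgebra.ι ℂ V1c - algebraMap ℂ _ u₁) * (FreeAlgebra.ι ℂ V1c + algebraMap ℂ _ u₁⁻¹)) 0
  | prod_left : HIIIRel r k₁ u₀ u₁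
      (r • (FreeAlgebra.ι ℂ V1c * FreeAlgebra.ι ℂ V1 * FreeAlgebra.ι ℂ V0))
      (FreeAlgebra.ι ℂ V0c + algebraMap ℂ _ u₀⁻¹)
  | prod_right : HIIIRel r k₁ u₀ u₁
      (r • (FreeAlgebra.ι ℂ V0c * FreeAlgebra.ι ℂ V1c * FreeAlgebra.ι ℂ V1))
      (FreeAlgebra.ι ℂ V0)

/-- The confluent Cherednik algebra `H_III`: the unital associative `ℂ`-algebra presented by the
four generators and the relations above. -/
abbrev HIII (r k₁ u₀ u₁ : ℂ) : Type := RingQuot (HIIIRel r k₁ u₀ u₁)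

/-- The image of a generator in `H_III`. -/
noncomputable def HIII.gen (r k₁ u₀ u₁ : ℂ) (g : HIIIGen) : HIII r k₁ u₀ u₁ :=
  RingQuot.mkAlgHom ℂ (HIIIRel r k₁ u₀ u₁) (FreeAlgebra.ι ℂ g)

/-- The antisymmetric form on exponents given by `[S₁,S₂] = [S₂,S₃] = [S₃,S₁] = iπħ`:
`[v₀ S₁ + v₁ S₂ + v₂ S₃, w₀ S₁ + w₁ S₂ + w₂ S₃] = (shearForm v w) iπħ`. -/
def shearForm (v w : Fin 3 → ℤ) : ℤ :=
  (v 0 * w 1 - v 1 * w 0) + (v 1 * w 2 - v 2 * w 1) + (v 2 * w 0 - v 0 * w 2)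

/-- The defining relations of the quantum torus. The generator indexed by `v` is the exponential
`e^{v₀ S₁ + v₁ S₂ + v₂ S₃}`; the product rule is `e^A e^B = e^{[A,B]/2} e^{A+B}` with
`q = e^{-iπħ}` and `r = q^{1/2} = e^{-iπħ/2}`; the last relation is `u₀ = -i e^{-S₁-S₂-S₃}`. -/
inductive QTorusRel (r u₀ : ℂ) :
    FreeAlgebra ℂ (Fin 3 → ℤ) → FreeAlgebra ℂ (Fin 3 → ℤ) → Prop
  | exp_zero : QTorusRel r u₀ (FreeAlgebra.ι ℂ 0) 1
  | exp_mul (v w : Fin 3 → ℤ) : QTorusRel r u₀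
      (FreeAlgebra.ι ℂ v * FreeAlgebra.ι ℂ w)
      (r ^ (-shearForm v w) • FreeAlgebra.ι ℂ (v + w))
  | central : QTorusRel r u₀
      (-Complex.I • FreeAlgebra.ι ℂ (![-1, -1, -1] : Fin 3 → ℤ)) (algebraMap ℂ _ u₀)

/-- The quantum torus `𝕋_q` in the exponentials of `S₁, S₂, S₃`, with `u₀ = -i e^{-S₁-S₂-S₃}`. -/
abbrev QTorus (r u₀ : ℂ) : Type := RingQuot (QTorusRel r u₀)

/-- The element `e^{a S₁ + b S₂ + c S₃}` of the quantum torus. -/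
noncomputable def qexp (r u₀ : ℂ) (a b c : ℤ) : QTorus r u₀ :=
  RingQuot.mkAlgHom ℂ (QTorusRel r u₀) (FreeAlgebra.ι ℂ ![a, b, c])

/-- The off-diagonal element `s`, products of exponentials being taken in the order written:
`s = (1/k₁ - k₁) e^{-S₁}e^{S₃} + (1/u₁ - u₁) e^{S₂}e^{S₃}
     + i e^{-S₁}e^{-S₂}e^{S₃} + i e^{-S₁}e^{S₂}e^{S₃}`. -/
noncomputable def sIII (r k₁ u₀ u₁ : ℂ) : QTorus r u₀ :=
  (1 / k₁ - k₁) • (qexp r u₀ (-1) 0 0 * qexp r u₀ 0 0 1)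
    + (1 / u₁ - u₁) • (qexp r u₀ 0 1 0 * qexp r u₀ 0 0 1)
    + Complex.I • (qexp r u₀ (-1) 0 0 * qexp r u₀ 0 (-1) 0 * qexp r u₀ 0 0 1)
    + Complex.I • (qexp r u₀ (-1) 0 0 * qexp r u₀ 0 1 0 * qexp r u₀ 0 0 1)

/-- The four matrices over the quantum torus assigned to the generators of `H_III`. -/
noncomputable def matIII (r k₁ u₀ u₁ : ℂ) :
    HIIIGen → Matrix (Fin 2) (Fin 2) (QTorus r u₀)
  | .V0 => !![0, 0;
              Complex.I • qexp r u₀ 0 0 1, 0]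
  | .V1 => !![algebraMap ℂ _ (k₁ - k₁⁻¹) - Complex.I • qexp r u₀ 0 1 0,
              algebraMap ℂ _ (k₁ - k₁⁻¹) - Complex.I • qexp r u₀ 0 (-1) 0
                - Complex.I • qexp r u₀ 0 1 0;
              Complex.I • qexp r u₀ 0 1 0,
              Complex.I • qexp r u₀ 0 1 0]
  | .V1c => !![0, -(Complex.I • qexp r u₀ 1 0 0);
               Complex.I • qexp r u₀ (-1) 0 0, algebraMap ℂ _ (u₁ - u₁⁻¹)]
  | .V0c => !![0, 0;
               r • sIII r k₁ u₀ u₁, -algebraMap ℂ _ (1 / u₀)]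

/-! Write `a, b, c, d` for the generators `V₀, V₁, V̌₁, V̌₀` and `w = c b`. The two Hecke relations
make `w` invertible, and the remaining relations say how `a` and `b` move past Laurent polynomials
in `w`: up to an error that is again a Laurent polynomial in `w`, `b` acts by `T ↦ T⁻¹` and `a` by
`T ↦ q⁻¹T⁻¹` (`heckeTwist_b`, `heckeTwist_a`). Since `c = w (b - K)`, with `K = k₁ - k₁⁻¹`, and `d =
r w a - u₀⁻¹`, the alternating words in `a` and `b`, indexed by `ℤ`, span `H_III` as a left module
over `ℂ[w, w⁻¹]`.

These words stay independent in every algebra where the same relations hold and the Laurent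
polynomials in `w` embed. To see this, replace each letter `s` by the intertwiner `s w - w s`, which
moves past Laurent polynomials with no error and whose square is a nonzero Laurent polynomial
(`HeckeTwist.intertwiner_mul`, `HeckeTwist.intertwiner_sq`). Alternating words in intertwiners are
nonzero eigenvectors of right multiplication by `w`. As `q` is not a root of unity, the eigenvalues
are distinct, so these words are independent (`zigzag_intertwiner_independent`). Those with at most
`N` letters lie in the span of the equally many ordinary words with at most `N` letters, so the
ordinary words are independent too (`zigzag_independent`).

A homomorphism out of `H_III` is therefore injective once it is injective on `ℂ[w, w⁻¹]`
(`injective_of_zigzagSpan`). For the given matrices this means that the image of `w` satisfies no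
polynomial equation. In a representation on pairs of functions on `ℤ`, that image raises the top of
the support of a suitable vector by exactly one at each step (`aeval_V1c_mul_V1_injective`). -/

/-! ### Laurent polynomials: evaluation at a unit and the reflections `T ↦ z T⁻¹` -/

section LaurentEval

open LaurentPolynomial

/-- Evaluation of Laurent polynomials at a unit of a possibly noncommutative algebra. -/
noncomputable def laurentEval {R : Type*} [Ring R] [Algebra ℂ R] (u : Rˣ) : ℂ[T;T⁻¹] →ₐ[ℂ] R :=
  AddMonoidAlgebra.lift ℂ R ℤ ((Units.coeHom R).comp (zpowersHom Rˣ u))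

theorem laurentEval_T {R : Type*} [Ring R] [Algebra ℂ R] (u : Rˣ) (n : ℤ) :
    laurentEval u (T n) = ((u ^ n : Rˣ) : R) := by
  rw [laurentEval, T, AddMonoidAlgebra.lift_single]
  simp [zpowersHom_apply]

theorem map_C_mul_T {R : Type*} [Ring R] [Algebra ℂ R] (F : ℂ[T;T⁻¹] →ₐ[ℂ] R) (c : ℂ) (n : ℤ) :
    F (C c * T n) = c • F (T n) := by
  rw [← smul_eq_C_mul, map_smul]

/-- The unit `z T⁻¹` of the Laurent polynomial ring. -/
noncomputable def flipUnit (z : ℂˣ) : (ℂ[T;T⁻¹])ˣ where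
  val := C (z : ℂ) * T (-1)
  inv := C ((z⁻¹ : ℂˣ) : ℂ) * T 1
  val_inv := by
    rw [mul_mul_mul_comm, ← map_mul, ← T_add]; simp
  inv_val := by
    rw [mul_mul_mul_comm, ← map_mul, ← T_add]; simp

theorem flipUnit_zpow (z : ℂˣ) (n : ℤ) :
    ((flipUnit z ^ n : (ℂ[T;T⁻¹])ˣ) : ℂ[T;T⁻¹]) = C ((z : ℂ) ^ n) * T (-n) := by
  induction n using Int.induction_on with
  | zero => simp
  | succ i ih =>
    rw [zpow_add_one, Units.val_mul, ih, zpow_add_one₀ z.ne_zero, neg_add, T_add, map_mul]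
    change _ * (C (z : ℂ) * T (-1)) = _
    ring
  | pred i ih =>
    rw [zpow_sub_one, Units.val_mul, ih, zpow_sub_one₀ z.ne_zero, neg_sub, sub_neg_eq_add,
      add_comm (1 : ℤ), T_add, map_mul]
    change _ * (C ((z⁻¹ : ℂˣ) : ℂ) * T 1) = _
    rw [Units.val_inv_eq_inv_val]
    ring_nf

/-- The substitution `T ↦ z T⁻¹`. -/
noncomputable def flipHom (z : ℂˣ) : ℂ[T;T⁻¹] →ₐ[ℂ] ℂ[T;T⁻¹] := laurentEval (flipUnit z)

theorem flipHom_T (z : ℂˣ) (n : ℤ) : flipHom z (T n) = C ((z : ℂ) ^ n) * T (-n) := by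
  rw [flipHom, laurentEval_T, flipUnit_zpow]

theorem flipHom_C (z : ℂˣ) (c : ℂ) : flipHom z (C c) = C c := by
  rw [C_eq_algebraMap]; exact (flipHom z).commutes c

theorem flipHom_flipHom (z : ℂˣ) (f : ℂ[T;T⁻¹]) : flipHom z (flipHom z f) = f := by
  induction f using LaurentPolynomial.induction_on' with
  | add p q hp hq => rw [map_add, map_add, hp, hq]
  | C_mul_T n a =>
    rw [map_mul, map_mul, flipHom_C, flipHom_C, flipHom_T, map_mul, flipHom_C, flipHom_T,
      neg_neg, ← mul_assoc (C _) (C _) (T n), ← map_mul, ← zpow_add₀ z.ne_zero]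
    simp

theorem flipHom_injective (z : ℂˣ) : Function.Injective (flipHom z) :=
  Function.LeftInverse.injective (flipHom_flipHom z)

end LaurentEval

/-! ### Alternating words indexed by the integers -/

section Zigzag

variable {R : Type*} [Ring R]

/-- The alternating product `s t s ⋯` with `n` factors. -/
def altProd : ℕ → R → R → R
  | 0, _, _ => 1
  | n + 1, s, t => s * altProd n t s

/-- Alternating products indexed by `ℤ`: those with `n > 0` start with `b`, those with `n < 0`
start with `a`. -/
def zigzag (a b : R) : ℤ → R
  | Int.ofNat n => altProd n b a
  | Int.negSucc n => altProd (n + 1) a b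

theorem zigzag_zero (a b : R) : zigzag a b 0 = 1 := rfl

theorem zigzag_one_sub (a b : R) {n : ℤ} (hn : n ≤ 0) :
    zigzag a b (1 - n) = b * zigzag a b n := by
  rcases n with n | n
  · obtain rfl : n = 0 := by simpa using hn
    rfl
  · rw [show 1 - Int.negSucc n = Int.ofNat (n + 2) by simp [Int.negSucc_eq]; ring]
    rfl

theorem zigzag_neg_one_sub (a b : R) {n : ℤ} (hn : 0 ≤ n) :
    zigzag a b (-1 - n) = a * zigzag a b n := by
  rcases n with n | n
  · rw [show -1 - Int.ofNat n = Int.negSucc n by simp [Int.negSucc_eq]; ring]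
    rfl
  · exact absurd hn (by simp)

/-- Prefixing a letter is a reflection of the index: `0, 1, -2, 3, …` and `0, -1, 2, -3, …` together
reach every integer. -/
theorem zigzag_induction {P : ℤ → Prop} (h0 : P 0) (hb : ∀ n ≤ 0, P n → P (1 - n))
    (ha : ∀ n, 0 ≤ n → P n → P (-1 - n)) (n : ℤ) : P n := by
  have key : ∀ m : ℕ, P m ∧ P (-m) := by
    intro m
    induction m with
    | zero => exact ⟨by simpa using h0, by simpa using h0⟩
    | succ m ih =>
      constructor
      · have := hb (-m) (by simp) ih.2
        rwa [show (1 : ℤ) - -m = (m + 1 : ℕ) by push_cast; ring] at this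
      · have := ha m (by simp) ih.1
        rwa [show (-1 : ℤ) - m = -(m + 1 : ℕ) by push_cast; ring] at this
  obtain ⟨m, rfl | rfl⟩ := n.eq_nat_or_neg
  exacts [(key m).1, (key m).2]

end Zigzag

/-! ### Bernstein relations and intertwiners -/

section Twist

open LaurentPolynomial

variable {R : Type*} [Ring R] [Algebra ℂ R]

theorem intertwine_of_T (F : ℂ[T;T⁻¹] →ₐ[ℂ] R) (σ : ℂ[T;T⁻¹] →ₐ[ℂ] ℂ[T;T⁻¹]) (s : R)
    (h : s * F (T 1) = F (σ (T 1)) * s) (f : ℂ[T;T⁻¹]) : s * F f = F (σ f) * s := by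
  have h' : s * F (T (-1)) = F (σ (T (-1))) * s := by
    -- Inserting `F (σ (T⁻¹ T)) = 1` on the left lets `h` be read backwards.
    calc s * F (T (-1)) = F (σ (T (-1) * T 1)) * (s * F (T (-1))) := by
          rw [← T_add]; simp
      _ = F (σ (T (-1))) * ((F (σ (T 1)) * s) * F (T (-1))) := by
          rw [map_mul, map_mul]; noncomm_ring
      _ = F (σ (T (-1))) * (s * F (T 1 * T (-1))) := by rw [← h, map_mul]; noncomm_ring
      _ = _ := by rw [← T_add]; simp
  have key : ∀ n : ℤ, s * F (T n) = F (σ (T n)) * s := by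
    intro n
    induction n using Int.induction_on with
    | zero => simp
    | succ i ih => rw [T_add, map_mul, ← mul_assoc, ih, mul_assoc, h, map_mul, map_mul, mul_assoc]
    | pred i ih =>
      rw [sub_eq_add_neg, T_add, map_mul, ← mul_assoc, ih, mul_assoc, h', map_mul, map_mul,
        mul_assoc]
  induction f using LaurentPolynomial.induction_on' with
  | add p q hp hq => simp only [map_add, mul_add, add_mul, hp, hq]
  | C_mul_T n a =>
    rw [← smul_eq_C_mul]; simp only [map_smul, mul_smul_comm, smul_mul_assoc, key]

/-- The error term is a twisted derivation, so the `f` for which it exists are closed under sums and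
products. Only `T⁻¹` needs its own computation. -/
theorem exists_twist_of_T (F : ℂ[T;T⁻¹] →ₐ[ℂ] R) (σ : ℂ[T;T⁻¹] →ₐ[ℂ] ℂ[T;T⁻¹]) (s : R)
    (g : ℂ[T;T⁻¹]) (h : s * F (T 1) = F (σ (T 1)) * s + F g) (f : ℂ[T;T⁻¹]) :
    ∃ g', s * F f = F (σ f) * s + F g' := by
  have hmul : ∀ f₁ f₂ : ℂ[T;T⁻¹], (∃ g', s * F f₁ = F (σ f₁) * s + F g') →
      (∃ g', s * F f₂ = F (σ f₂) * s + F g') → ∃ g', s * F (f₁ * f₂) = F (σ (f₁ * f₂)) * s + F g' := by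
    rintro f₁ f₂ ⟨g₁, h₁⟩ ⟨g₂, h₂⟩
    refine ⟨σ f₁ * g₂ + g₁ * f₂, ?_⟩
    rw [map_mul, ← mul_assoc, h₁, add_mul, mul_assoc, h₂]
    simp only [map_mul, map_add]
    noncomm_ring
  have h' : ∃ g', s * F (T (-1)) = F (σ (T (-1))) * s + F g' := by
    refine ⟨-(σ (T (-1)) * g * T (-1)), ?_⟩
    calc s * F (T (-1)) = F (σ (T (-1) * T 1)) * (s * F (T (-1))) := by
          rw [← T_add]; simp
      _ = F (σ (T (-1))) * ((F (σ (T 1)) * s) * F (T (-1))) := by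
          rw [map_mul, map_mul]; noncomm_ring
      _ = F (σ (T (-1))) * (s * F (T 1 * T (-1))) - F (σ (T (-1)) * g * T (-1)) := by
          rw [← sub_eq_iff_eq_add.mpr h, map_mul, map_mul, map_mul]; noncomm_ring
      _ = _ := by rw [← T_add, map_neg]; simp [sub_eq_add_neg]
  have key : ∀ n : ℤ, ∃ g', s * F (T n) = F (σ (T n)) * s + F g' := by
    intro n
    induction n using Int.induction_on with
    | zero => exact ⟨0, by simp⟩
    | succ i ih => rw [T_add]; exact hmul _ _ ih ⟨g, h⟩
    | pred i ih => rw [sub_eq_add_neg, T_add]; exact hmul _ _ ih h'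
  induction f using LaurentPolynomial.induction_on' with
  | add p q hp hq =>
    obtain ⟨g₁, h₁⟩ := hp
    obtain ⟨g₂, h₂⟩ := hq
    exact ⟨g₁ + g₂, by simp only [map_add, mul_add, add_mul, h₁, h₂]; abel⟩
  | C_mul_T n a =>
    obtain ⟨g', h'⟩ := key n
    refine ⟨a • g', ?_⟩
    rw [← smul_eq_C_mul]; simp only [map_smul, mul_smul_comm, smul_mul_assoc, h', smul_add]

/-- The Bernstein-type relations between a Hecke generator `s` and the Laurent polynomials in an
invertible element on which `s` acts by the reflection `T ↦ z T⁻¹`. -/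
structure HeckeTwist (F : ℂ[T;T⁻¹] →ₐ[ℂ] R) (z : ℂˣ) (g : ℂ[T;T⁻¹]) (α β : ℂ) (s : R) : Prop where
  mul_T : s * F (T 1) = F (flipHom z (T 1)) * s + F g
  sq : s * s = α • s + β • 1
  flip_g : flipHom z g = g + α • (flipHom z (T 1) - T 1)
  disc_ne_zero : g * flipHom z g - β • (flipHom z (T 1) - T 1) ^ 2 ≠ 0

/-- The intertwiner attached to a Hecke generator. -/
noncomputable def intertwiner (F : ℂ[T;T⁻¹] →ₐ[ℂ] R) (s : R) : R := s * F (T 1) - F (T 1) * s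

namespace HeckeTwist

variable {F : ℂ[T;T⁻¹] →ₐ[ℂ] R} {z : ℂˣ} {g : ℂ[T;T⁻¹]} {α β : ℂ} {s : R}

theorem map {R' : Type*} [Ring R'] [Algebra ℂ R'] (h : HeckeTwist F z g α β s) (φ : R →ₐ[ℂ] R') :
    HeckeTwist (φ.comp F) z g α β (φ s) where
  mul_T := by simpa using congrArg φ h.mul_T
  sq := by simpa using congrArg φ h.sq
  flip_g := h.flip_g
  disc_ne_zero := h.disc_ne_zero

theorem intertwiner_eq (h : HeckeTwist F z g α β s) :
    intertwiner F s = F (flipHom z (T 1) - T 1) * s + F g := by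
  rw [intertwiner, h.mul_T, map_sub, sub_mul]; abel

theorem intertwiner_mul_eq (h : HeckeTwist F z g α β s) (y : R) :
    intertwiner F s * y = F (flipHom z (T 1) - T 1) * (s * y) + F g * y := by
  rw [h.intertwiner_eq, add_mul, mul_assoc]

/-- It is enough to check `T`. There, with `δ = σT - T`, both sides are `σT (δ s + g)`. -/
theorem intertwiner_mul (h : HeckeTwist F z g α β s) (f : ℂ[T;T⁻¹]) :
    intertwiner F s * F f = F (flipHom z f) * intertwiner F s := by
  apply intertwine_of_T
  rw [h.intertwiner_eq, add_mul, mul_assoc, h.mul_T, mul_add, mul_add]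
  simp only [← mul_assoc, ← map_mul, add_assoc, ← map_add]
  have e : ∀ A B A' B' : ℂ[T;T⁻¹], A = A' → B = B' → F A * s + F B = F A' * s + F B' := by
    rintro A B A' B' rfl rfl; rfl
  apply e <;> ring

/-- With `δ = σT - T`, which `σ` negates, the hypothesis on `σ g` gives `I s = σ(g) s + β δ`. In `I
(δ s + g) = -δ (I s) + σ(g) I` the terms in `s` then cancel. -/
theorem intertwiner_sq (h : HeckeTwist F z g α β s) :
    intertwiner F s * intertwiner F s =
      F (g * flipHom z g - β • (flipHom z (T 1) - T 1) ^ 2) := by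
  have hδ : flipHom z (flipHom z (T 1) - T 1) = -(flipHom z (T 1) - T 1) := by
    rw [map_sub, flipHom_flipHom]; ring
  have hs : intertwiner F s * s =
      F (flipHom z g) * s + F (β • (flipHom z (T 1) - T 1)) := by
    rw [h.intertwiner_eq, h.flip_g, add_mul, mul_assoc, h.sq]
    simp only [mul_add, mul_smul_comm, map_add, map_smul, add_mul, smul_mul_assoc, mul_one]
    abel
  conv_lhs => rw [h.intertwiner_eq]
  rw [← h.intertwiner_eq]
  conv_lhs => rhs; rw [h.intertwiner_eq]
  rw [mul_add, ← mul_assoc, h.intertwiner_mul, h.intertwiner_mul, hδ, mul_assoc, hs,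
    h.intertwiner_eq, mul_add, mul_add]
  simp only [← mul_assoc, ← map_mul]
  have e : ∀ A B A' B' : ℂ[T;T⁻¹], A + A' = 0 →
      F A * s + F B + (F A' * s + F B') = F (B + B') := by
    intro A B A' B' hA
    rw [map_add, eq_neg_of_add_eq_zero_right hA, map_neg]
    noncomm_ring
  rw [e]
  · congr 1; rw [smul_eq_C_mul, smul_eq_C_mul]; ring
  · ring

/-- A second intertwiner on the left turns the product into `σ f` times the nonzero square, applied
to `y`. -/
theorem eq_zero_of_mul_intertwiner (h : HeckeTwist F z g α β s) {y : R}
    (hy : ∀ f, F f * y = 0 → f = 0) (f : ℂ[T;T⁻¹]) (hf : F f * (intertwiner F s * y) = 0) :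
    f = 0 := by
  have h1 : intertwiner F s * (F f * (intertwiner F s * y)) = 0 := by rw [hf, mul_zero]
  rw [← mul_assoc, h.intertwiner_mul, mul_assoc, ← mul_assoc (intertwiner F s),
    h.intertwiner_sq, ← mul_assoc, ← map_mul] at h1
  have h2 := (mul_eq_zero.mp (hy _ h1)).resolve_right h.disc_ne_zero
  exact (map_eq_zero_iff _ (flipHom_injective z)).mp h2

end HeckeTwist

theorem map_zigzag {R' : Type*} [Ring R'] [Algebra ℂ R'] (φ : R →ₐ[ℂ] R') (a b : R) (n : ℤ) :
    φ (zigzag a b n) = zigzag (φ a) (φ b) n := by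
  induction n using zigzag_induction with
  | h0 => simp [zigzag_zero]
  | hb n hn ih => rw [zigzag_one_sub _ _ hn, zigzag_one_sub _ _ hn, map_mul, ih]
  | ha n hn ih => rw [zigzag_neg_one_sub _ _ hn, zigzag_neg_one_sub _ _ hn, map_mul, ih]

/-- The eigenvalues of right multiplication by `F T` on alternating products of intertwiners. -/
noncomputable def zigzagEigenvalue (q : ℂ) (n : ℤ) : ℂ[T;T⁻¹] :=
  if Even n then C (q ^ (-(n / 2))) * T 1 else C (q ^ ((n - 1) / 2)) * T (-1)

theorem zigzagEigenvalue_zero (q : ℂ) : zigzagEigenvalue q 0 = T 1 := by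
  simp [zigzagEigenvalue]

/-- Together with its analogue for `q⁻¹` and the value `T` at `0`, this equivariance under the two
reflections of the index determines the eigenvalues. -/
theorem flipHom_one_zigzagEigenvalue (q : ℂ) (n : ℤ) :
    flipHom 1 (zigzagEigenvalue q n) = zigzagEigenvalue q (1 - n) := by
  rcases Int.even_or_odd n with hn | hn
  · rw [zigzagEigenvalue, if_pos hn, zigzagEigenvalue, if_neg (by grind), map_mul, flipHom_C,
      flipHom_T, show (1 - n - 1) / 2 = -(n / 2) by grind]
    simp
  · rw [zigzagEigenvalue, if_neg (by grind), zigzagEigenvalue, if_pos (by grind), map_mul,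
      flipHom_C, flipHom_T, show -((1 - n) / 2) = (n - 1) / 2 by grind]
    simp

theorem flipHom_inv_zigzagEigenvalue (q : ℂˣ) (n : ℤ) :
    flipHom q⁻¹ (zigzagEigenvalue q n) = zigzagEigenvalue q (-1 - n) := by
  rcases Int.even_or_odd n with hn | hn
  · rw [zigzagEigenvalue, if_pos hn, zigzagEigenvalue, if_neg (by grind), map_mul, flipHom_C,
      flipHom_T, show (-1 - n - 1) / 2 = -(n / 2) - 1 by grind, zpow_sub_one₀ q.ne_zero,
      map_mul, mul_assoc]
    simp
  · rw [zigzagEigenvalue, if_neg (by grind), zigzagEigenvalue, if_pos (by grind), map_mul,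
      flipHom_C, flipHom_T, show -((-1 - n) / 2) = (n - 1) / 2 + 1 by grind,
      zpow_add_one₀ q.ne_zero, map_mul, mul_assoc]
    simp

theorem C_mul_T_inj {c d : ℂ} (hc : c ≠ 0) {m n : ℤ} (h : C c * T m = C d * T n) :
    m = n ∧ c = d := by
  have h1 := congrArg (fun f : ℂ[T;T⁻¹] => f.coeff m) h
  simp only [← smul_eq_C_mul] at h1
  by_cases hmn : n = m
  · subst hmn; exact ⟨rfl, by simpa using h1⟩
  · exact absurd h1 (by simp [hmn, hc])

theorem zigzagEigenvalue_injective {q : ℂ} (hq0 : q ≠ 0) (hq : ∀ m : ℕ, 0 < m → q ^ m ≠ 1) :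
    Function.Injective (zigzagEigenvalue q) := by
  have hz : Function.Injective (fun n : ℤ => q ^ n) := by
    have hne : ∀ n : ℤ, q ^ n = 1 → n = 0 := by
      intro n hn
      obtain ⟨m, rfl | rfl⟩ := n.eq_nat_or_neg
      · by_contra h
        exact hq m (by omega) (by simpa using hn)
      · by_contra h
        exact hq m (by omega) (by simpa using hn)
    intro m n h
    have := hne (m - n) (by rw [zpow_sub₀ hq0, div_eq_one_iff_eq (zpow_ne_zero _ hq0)]; exact h)
    omega
  intro m n h
  unfold zigzagEigenvalue at h
  split_ifs at h with h1 h2 h2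
  · have := hz (C_mul_T_inj (zpow_ne_zero _ hq0) h).2
    grind
  · exact absurd (C_mul_T_inj (zpow_ne_zero _ hq0) h).1 (by norm_num)
  · exact absurd (C_mul_T_inj (zpow_ne_zero _ hq0) h).1 (by norm_num)
  · have := hz (C_mul_T_inj (zpow_ne_zero _ hq0) h).2
    grind

end Twist

/-! ### Linear independence of the alternating words -/

section Independence

open LaurentPolynomial Finset

variable {R : Type*} [Ring R] [Algebra ℂ R]

theorem sum_map_vecMul {ι : Type*} [Fintype ι] (F : ℂ[T;T⁻¹] →ₐ[ℂ] R) {u v : ι → R}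
    {A : Matrix ι ι ℂ[T;T⁻¹]} (hu : ∀ i, u i = ∑ j, F (A i j) * v j) (c : ι → ℂ[T;T⁻¹]) :
    ∑ i, F (c i) * u i = ∑ j, F (Matrix.vecMul c A j) * v j := by
  simp only [hu, Matrix.vecMul, dotProduct, map_sum, map_mul, sum_mul, mul_sum, mul_assoc]
  exact sum_comm

/-- If the entries of `u` are independent and lie in the span of the equally many entries of `v`,
then the entries of `v` are independent. -/
theorem independent_of_eq_sum {ι : Type*} [Fintype ι] [DecidableEq ι] (F : ℂ[T;T⁻¹] →ₐ[ℂ] R)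
    {u v : ι → R} {A : Matrix ι ι ℂ[T;T⁻¹]} (hu : ∀ i, u i = ∑ j, F (A i j) * v j)
    (hind : ∀ c : ι → ℂ[T;T⁻¹], ∑ i, F (c i) * u i = 0 → c = 0)
    (c : ι → ℂ[T;T⁻¹]) (hc : ∑ i, F (c i) * v i = 0) : c = 0 := by
  -- A singular matrix would have a nonzero left null vector, which is a relation among the `u i`.
  -- Afterwards the adjugate stands in for the inverse, as in Cramer's rule.
  have hdet : A.det ≠ 0 := by
    intro h0
    obtain ⟨d, hd0, hd⟩ := Matrix.exists_vecMul_eq_zero_iff.mpr h0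
    refine hd0 (hind d ?_)
    rw [sum_map_vecMul F hu, hd]
    simp
  have h1 : Matrix.vecMul c A.adjugate = 0 := by
    apply hind
    rw [sum_map_vecMul F hu, Matrix.vecMul_vecMul, Matrix.adjugate_mul]
    simp only [Matrix.vecMul_smul, Matrix.vecMul_one, Pi.smul_apply, smul_eq_mul, map_mul,
      mul_assoc]
    rw [← mul_sum, hc, mul_zero]
  have h2 : A.det • c = 0 := by
    rw [← Matrix.vecMul_one c, ← Matrix.vecMul_smul, ← Matrix.adjugate_mul,
      ← Matrix.vecMul_vecMul, h1, Matrix.zero_vecMul]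
  exact (smul_eq_zero.mp h2).resolve_left hdet

/-- The left span of the alternating products with at most `N` factors. -/
def InZigzagSpan (F : ℂ[T;T⁻¹] →ₐ[ℂ] R) (a b : R) (N : ℕ) (y : R) : Prop :=
  ∃ f : ℤ → ℂ[T;T⁻¹], y = ∑ n ∈ Icc (-(N : ℤ)) N, F (f n) * zigzag a b n

namespace InZigzagSpan

variable {F : ℂ[T;T⁻¹] →ₐ[ℂ] R} {a b : R} {N : ℕ} {y y' : R}

theorem zero : InZigzagSpan F a b N 0 := ⟨0, by simp⟩

theorem add (h : InZigzagSpan F a b N y) (h' : InZigzagSpan F a b N y') :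
    InZigzagSpan F a b N (y + y') := by
  obtain ⟨f, rfl⟩ := h
  obtain ⟨f', rfl⟩ := h'
  exact ⟨f + f', by simp [add_mul, sum_add_distrib]⟩

theorem mul_left (h : InZigzagSpan F a b N y) (g : ℂ[T;T⁻¹]) :
    InZigzagSpan F a b N (F g * y) := by
  obtain ⟨f, rfl⟩ := h
  exact ⟨fun n => g * f n, by simp [mul_sum, mul_assoc]⟩

theorem smul (h : InZigzagSpan F a b N y) (c : ℂ) : InZigzagSpan F a b N (c • y) := by
  have := h.mul_left (algebraMap ℂ _ c)
  rwa [AlgHom.commutes, ← Algebra.smul_def] at this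

theorem sum {ι : Type*} {s : Finset ι} {f : ι → R} (h : ∀ i ∈ s, InZigzagSpan F a b N (f i)) :
    InZigzagSpan F a b N (∑ i ∈ s, f i) :=
  Finset.sum_induction f (InZigzagSpan F a b N) (fun _ _ => add) zero h

theorem zigzag_mem {n : ℤ} (hn : |n| ≤ N) : InZigzagSpan F a b N (zigzag a b n) := by
  refine ⟨Pi.single n 1, ?_⟩
  rw [Finset.sum_eq_single n]
  · simp
  · intro m _ hm
    simp [hm]
  · intro h
    exact absurd (mem_Icc.mpr (abs_le.mp hn)) h

theorem mono {N' : ℕ} (h : InZigzagSpan F a b N y) (hN : N ≤ N') : InZigzagSpan F a b N' y := by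
  obtain ⟨f, rfl⟩ := h
  refine sum fun n hn => (zigzag_mem ?_).mul_left _
  have := abs_le.mpr (mem_Icc.mp hn)
  omega

theorem mul_of_zigzag {z : ℂˣ} {g : ℂ[T;T⁻¹]} {α β : ℂ} {s : R} (hs : HeckeTwist F z g α β s)
    (hz : ∀ n : ℤ, |n| ≤ N → InZigzagSpan F a b (N + 1) (s * zigzag a b n))
    (h : InZigzagSpan F a b N y) : InZigzagSpan F a b (N + 1) (s * y) := by
  obtain ⟨f, rfl⟩ := h
  rw [mul_sum]
  refine sum fun n hn => ?_
  have hn' := abs_le.mpr (mem_Icc.mp hn)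
  obtain ⟨g', hg'⟩ := exists_twist_of_T F (flipHom z) s g hs.mul_T (f n)
  rw [← mul_assoc, hg', add_mul, mul_assoc]
  exact ((hz n hn').mul_left _).add ((zigzag_mem (by push_cast; omega)).mul_left _)

theorem mul_b {z : ℂˣ} {g : ℂ[T;T⁻¹]} {α β : ℂ} (hb : HeckeTwist F z g α β b)
    (h : InZigzagSpan F a b N y) : InZigzagSpan F a b (N + 1) (b * y) := by
  refine h.mul_of_zigzag hb fun n hn => ?_
  rcases le_or_gt n 0 with h0 | h0
  · rw [← zigzag_one_sub _ _ h0]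
    exact zigzag_mem (by rw [abs_le] at *; push_cast; omega)
  · obtain ⟨m, rfl⟩ : ∃ m, n = 1 - m := ⟨1 - n, by ring⟩
    -- The word already begins with `b`, so the quadratic relation applies and no letter is gained.
    rw [zigzag_one_sub _ _ (by omega), ← mul_assoc, hb.sq, add_mul, smul_mul_assoc,
      smul_mul_assoc, one_mul, ← zigzag_one_sub _ _ (by omega)]
    exact ((zigzag_mem (by push_cast; omega)).smul _).add
      ((zigzag_mem (by rw [abs_le] at *; push_cast; omega)).smul _)

theorem mul_a {z : ℂˣ} {g : ℂ[T;T⁻¹]} {α β : ℂ} (ha : HeckeTwist F z g α β a)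
    (h : InZigzagSpan F a b N y) : InZigzagSpan F a b (N + 1) (a * y) := by
  refine h.mul_of_zigzag ha fun n hn => ?_
  rcases le_or_gt 0 n with h0 | h0
  · rw [← zigzag_neg_one_sub _ _ h0]
    exact zigzag_mem (by rw [abs_le] at *; push_cast; omega)
  · obtain ⟨m, rfl⟩ : ∃ m, n = -1 - m := ⟨-1 - n, by ring⟩
    rw [zigzag_neg_one_sub _ _ (by omega), ← mul_assoc, ha.sq, add_mul, smul_mul_assoc,
      smul_mul_assoc, one_mul, ← zigzag_neg_one_sub _ _ (by omega)]
    exact ((zigzag_mem (by push_cast; omega)).smul _).add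
      ((zigzag_mem (by rw [abs_le] at *; push_cast; omega)).smul _)

end InZigzagSpan

section

variable {F : ℂ[T;T⁻¹] →ₐ[ℂ] R} {a b : R} {q : ℂˣ} {ga gb : ℂ[T;T⁻¹]} {αa βa αb βb : ℂ}

theorem zigzag_intertwiner_mul_T (ha : HeckeTwist F q⁻¹ ga αa βa a)
    (hb : HeckeTwist F 1 gb αb βb b) (n : ℤ) :
    zigzag (intertwiner F a) (intertwiner F b) n * F (T 1) =
      F (zigzagEigenvalue q n) * zigzag (intertwiner F a) (intertwiner F b) n := by
  induction n using zigzag_induction with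
  | h0 => simp [zigzag_zero, zigzagEigenvalue_zero]
  | hb n hn ih =>
    rw [zigzag_one_sub _ _ hn, mul_assoc, ih, ← mul_assoc, hb.intertwiner_mul,
      flipHom_one_zigzagEigenvalue, mul_assoc]
  | ha n hn ih =>
    rw [zigzag_neg_one_sub _ _ hn, mul_assoc, ih, ← mul_assoc, ha.intertwiner_mul,
      flipHom_inv_zigzagEigenvalue, mul_assoc]

theorem eq_zero_of_mul_zigzag_intertwiner (hF : Function.Injective F)
    (ha : HeckeTwist F q⁻¹ ga αa βa a) (hb : HeckeTwist F 1 gb αb βb b) (n : ℤ)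
    (f : ℂ[T;T⁻¹]) (hf : F f * zigzag (intertwiner F a) (intertwiner F b) n = 0) : f = 0 := by
  induction n using zigzag_induction generalizing f with
  | h0 => exact (map_eq_zero_iff F hF).mp (by simpa [zigzag_zero] using hf)
  | hb n hn ih =>
    rw [zigzag_one_sub _ _ hn] at hf
    exact hb.eq_zero_of_mul_intertwiner ih f hf
  | ha n hn ih =>
    rw [zigzag_neg_one_sub _ _ hn] at hf
    exact ha.eq_zero_of_mul_intertwiner ih f hf

/-- Eigenvector argument: multiplying the relation by `F T` on the right and subtracting `F` of the
`k`-th eigenvalue times it removes the `k`-th term. The other coefficients are multiplied by nonzero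
differences in a domain. -/
theorem zigzag_intertwiner_independent (hq : ∀ m : ℕ, 0 < m → (q : ℂ) ^ m ≠ 1)
    (hF : Function.Injective F) (ha : HeckeTwist F q⁻¹ ga αa βa a)
    (hb : HeckeTwist F 1 gb αb βb b) (s : Finset ℤ) (c : ℤ → ℂ[T;T⁻¹])
    (hc : ∑ n ∈ s, F (c n) * zigzag (intertwiner F a) (intertwiner F b) n = 0) :
    ∀ n ∈ s, c n = 0 := by
  induction s using Finset.induction_on generalizing c with
  | empty => simp
  | insert k s hk ih =>
    have h1 : ∑ n ∈ s, F (c n * (zigzagEigenvalue q n - zigzagEigenvalue q k)) *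
        zigzag (intertwiner F a) (intertwiner F b) n = 0 := by
      have h2 : ∑ n ∈ insert k s, F (c n * (zigzagEigenvalue q n - zigzagEigenvalue q k)) *
          zigzag (intertwiner F a) (intertwiner F b) n = 0 := by
        calc _ = (∑ n ∈ insert k s, F (c n) * zigzag (intertwiner F a) (intertwiner F b) n) *
              F (T 1) - F (zigzagEigenvalue q k) *
              ∑ n ∈ insert k s, F (c n) * zigzag (intertwiner F a) (intertwiner F b) n := by
              rw [sum_mul, mul_sum, ← sum_sub_distrib]
              refine sum_congr rfl fun n _ => ?_
              rw [mul_assoc, zigzag_intertwiner_mul_T ha hb, ← mul_assoc, ← mul_assoc, ← map_mul,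
                ← map_mul, ← sub_mul, ← map_sub]
              congr 2; ring
          _ = 0 := by rw [hc, zero_mul, mul_zero, sub_zero]
      rwa [sum_insert hk, sub_self, mul_zero, map_zero, zero_mul, zero_add] at h2
    have h3 : ∀ n ∈ s, c n = 0 := by
      intro n hn
      refine (mul_eq_zero.mp (ih _ h1 n hn)).resolve_right (sub_ne_zero.mpr fun h => hk ?_)
      rwa [← zigzagEigenvalue_injective q.ne_zero hq h]
    intro n hn
    rcases mem_insert.mp hn with rfl | hn
    · rw [sum_insert hk, sum_eq_zero fun m hm => by rw [h3 m hm, map_zero, zero_mul],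
        add_zero] at hc
      exact eq_zero_of_mul_zigzag_intertwiner hF ha hb _ _ hc
    · exact h3 n hn

theorem zigzag_intertwiner_mem (ha : HeckeTwist F q⁻¹ ga αa βa a)
    (hb : HeckeTwist F 1 gb αb βb b) (n : ℤ) :
    InZigzagSpan F a b n.natAbs (zigzag (intertwiner F a) (intertwiner F b) n) := by
  induction n using zigzag_induction with
  | h0 => exact InZigzagSpan.zigzag_mem (n := 0) (by simp)
  | hb n hn ih =>
    rw [zigzag_one_sub _ _ hn, hb.intertwiner_mul_eq,
      show (1 - n).natAbs = n.natAbs + 1 by omega]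
    exact ((ih.mul_b hb).mul_left _).add ((ih.mono (by omega)).mul_left _)
  | ha n hn ih =>
    rw [zigzag_neg_one_sub _ _ hn, ha.intertwiner_mul_eq,
      show (-1 - n).natAbs = n.natAbs + 1 by omega]
    exact ((ih.mul_a ha).mul_left _).add ((ih.mono (by omega)).mul_left _)

/-- Both families have the index set `[-N, N]`, so a square matrix relates them and its leading
coefficients need not be computed. -/
theorem zigzag_independent (hq : ∀ m : ℕ, 0 < m → (q : ℂ) ^ m ≠ 1)
    (hF : Function.Injective F) (ha : HeckeTwist F q⁻¹ ga αa βa a)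
    (hb : HeckeTwist F 1 gb αb βb b) (N : ℕ) (c : ℤ → ℂ[T;T⁻¹])
    (hc : ∑ n ∈ Icc (-(N : ℤ)) N, F (c n) * zigzag a b n = 0) :
    ∀ n ∈ Icc (-(N : ℤ)) N, c n = 0 := by
  have hmem : ∀ n : Icc (-(N : ℤ)) N,
      InZigzagSpan F a b N (zigzag (intertwiner F a) (intertwiner F b) n) := fun n =>
    (zigzag_intertwiner_mem ha hb n).mono (by have := mem_Icc.mp n.2; omega)
  choose A hA using hmem
  have := independent_of_eq_sum F (ι := Icc (-(N : ℤ)) N)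
    (u := fun n => zigzag (intertwiner F a) (intertwiner F b) n)
    (v := fun n => zigzag a b n) (A := fun i j => A i j)
    (fun i => by
      rw [hA]; exact (Finset.sum_coe_sort _ fun j => F (A i j) * zigzag a b j).symm)
    (fun d hd => by
      have h := zigzag_intertwiner_independent hq hF ha hb (Icc (-(N : ℤ)) N)
        (fun n => if h : n ∈ Icc (-(N : ℤ)) N then d ⟨n, h⟩ else 0) (by
          rw [← Finset.sum_coe_sort, ← hd]
          exact sum_congr rfl fun n _ => by rw [dif_pos n.2])
      funext n
      have hn := h n n.2
      rw [dif_pos n.2] at hn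
      exact hn)
    (fun n => c n) (by
      rw [← hc]; exact Finset.sum_coe_sort _ fun n => F (c n) * zigzag a b n)
  intro n hn
  exact congrFun this ⟨n, hn⟩

end

/-- An algebra homomorphism is injective as soon as it is injective on the Laurent polynomials,
if the alternating products span the source. -/
theorem injective_of_zigzagSpan {R' : Type*} [Ring R'] [Algebra ℂ R'] {F : ℂ[T;T⁻¹] →ₐ[ℂ] R}
    {a b : R} {q : ℂˣ} {ga gb : ℂ[T;T⁻¹]} {αa βa αb βb : ℂ}
    (hq : ∀ m : ℕ, 0 < m → (q : ℂ) ^ m ≠ 1) (ha : HeckeTwist F q⁻¹ ga αa βa a)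
    (hb : HeckeTwist F 1 gb αb βb b) (hspan : ∀ y, ∃ N, InZigzagSpan F a b N y)
    (φ : R →ₐ[ℂ] R') (hφ : Function.Injective (φ.comp F)) : Function.Injective φ := by
  rw [injective_iff_map_eq_zero]
  intro y hy
  obtain ⟨N, f, rfl⟩ := hspan y
  have h0 := zigzag_independent hq hφ (ha.map φ) (hb.map φ) N f (by
    simpa only [map_sum, map_mul, map_zigzag, AlgHom.comp_apply] using hy)
  exact sum_eq_zero fun n hn => by rw [h0 n hn, map_zero, zero_mul]

end Independence

/-! ### Products of exponentials in the quantum torus -/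

section QuantumTorus

theorem qexp_mul (r u₀ : ℂ) (a b c a' b' c' : ℤ) :
    qexp r u₀ a b c * qexp r u₀ a' b' c' =
      r ^ (-((a * b' - b * a') + (b * c' - c * b') + (c * a' - a * c'))) •
        qexp r u₀ (a + a') (b + b') (c + c') := by
  have h := RingQuot.mkAlgHom_rel ℂ (QTorusRel.exp_mul (r := r) (u₀ := u₀) ![a, b, c] ![a', b', c'])
  rw [map_mul, map_smul] at h
  simpa [shearForm, qexp] using h

theorem qexp_zero (r u₀ : ℂ) : qexp r u₀ 0 0 0 = 1 := by
  have h := RingQuot.mkAlgHom_rel ℂ (QTorusRel.exp_zero (r := r) (u₀ := u₀))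
  rw [map_one] at h
  rw [qexp, ← h]
  congr 2
  ext i; fin_cases i <;> rfl

theorem qexp_neg_one (r u₀ : ℂ) :
    qexp r u₀ (-1) (-1) (-1) = (Complex.I * u₀) • 1 := by
  have h := RingQuot.mkAlgHom_rel ℂ (QTorusRel.central (r := r) (u₀ := u₀))
  rw [map_smul, AlgHom.commutes, Algebra.algebraMap_eq_smul_one] at h
  rw [mul_smul, ← h, smul_smul, qexp]
  simp

theorem qexp_one (r : ℂ) {u₀ : ℂ} (hu₀ : u₀ ≠ 0) :
    qexp r u₀ 1 1 1 = (Complex.I * u₀)⁻¹ • 1 := by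
  have h := qexp_mul r u₀ 1 1 1 (-1) (-1) (-1)
  simp only [qexp_neg_one, mul_smul_comm, mul_one] at h
  norm_num [qexp_zero] at h
  rw [← h, smul_smul, inv_mul_cancel₀ (mul_ne_zero Complex.I_ne_zero hu₀), one_smul]

theorem qexp_one_zero_mul_neg (r u₀ : ℂ) : qexp r u₀ 1 0 0 * qexp r u₀ (-1) 0 0 = 1 := by
  simp [qexp_mul, qexp_zero]

theorem qexp_neg_mul_one_zero (r u₀ : ℂ) : qexp r u₀ (-1) 0 0 * qexp r u₀ 1 0 0 = 1 := by
  simp [qexp_mul, qexp_zero]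

theorem qexp_zero_one_mul_neg (r u₀ : ℂ) : qexp r u₀ 0 1 0 * qexp r u₀ 0 (-1) 0 = 1 := by
  simp [qexp_mul, qexp_zero]

theorem qexp_zero_neg_mul_one (r u₀ : ℂ) : qexp r u₀ 0 (-1) 0 * qexp r u₀ 0 1 0 = 1 := by
  simp [qexp_mul, qexp_zero]

theorem qexp_mul_three (r : ℂ) {u₀ : ℂ} (hu₀ : u₀ ≠ 0) :
    qexp r u₀ 1 0 0 * (qexp r u₀ 0 1 0 * qexp r u₀ 0 0 1) =
      (r⁻¹ * (Complex.I * u₀)⁻¹) • 1 := by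
  rw [← mul_assoc]
  simp [qexp_mul, qexp_one r hu₀, smul_smul, -mul_inv_rev]

theorem qexp_mul_three' (r : ℂ) {u₀ : ℂ} (hu₀ : u₀ ≠ 0) :
    qexp r u₀ 0 0 1 * (qexp r u₀ 1 0 0 * qexp r u₀ 0 1 0) =
      (r⁻¹ * (Complex.I * u₀)⁻¹) • 1 := by
  simp [qexp_mul, qexp_one r hu₀, smul_smul, -mul_inv_rev]

/-- Since `e^{-S₁-S₂-S₃}` is the scalar `i u₀`, `e^{-S₁-S₂}` is a multiple of `e^{S₃}`. -/
theorem qexp_neg_mul_neg (r u₀ : ℂ) :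
    qexp r u₀ (-1) 0 0 * qexp r u₀ 0 (-1) 0 = (Complex.I * u₀ * r⁻¹) • qexp r u₀ 0 0 1 := by
  have h := qexp_mul r u₀ (-1) (-1) (-1) 0 0 1
  simp [qexp_neg_one] at h
  simp [qexp_mul, ← h, smul_smul]
  ring_nf

end QuantumTorus

/-! ### The defining relations for the four matrices -/

section Relations

open Complex

variable {A : Type*} [Ring A] [Algebra ℂ A]

/-- The matrices `matIII` with the exponentials replaced by elements `X^{±1}`, `Y^{±1}`, `Z` of an
arbitrary algebra. -/
noncomputable def torusMat (r k₁ u₀ u₁ : ℂ) (X X' Y Y' Z : A) :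
    HIIIGen → Matrix (Fin 2) (Fin 2) A
  | .V0 => !![0, 0; I • Z, 0]
  | .V1 => !![algebraMap ℂ _ (k₁ - k₁⁻¹) - I • Y,
              algebraMap ℂ _ (k₁ - k₁⁻¹) - I • Y' - I • Y;
              I • Y, I • Y]
  | .V1c => !![0, -(I • X); I • X', algebraMap ℂ _ (u₁ - u₁⁻¹)]
  | .V0c => !![0, 0;
               r • ((1 / k₁ - k₁) • (X' * Z) + (1 / u₁ - u₁) • (Y * Z)
                 + I • (X' * Y' * Z) + I • (X' * Y * Z)),
               -algebraMap ℂ _ (1 / u₀)]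

theorem matIII_eq_torusMat (r k₁ u₀ u₁ : ℂ) (g : HIIIGen) :
    matIII r k₁ u₀ u₁ g = torusMat r k₁ u₀ u₁ (qexp r u₀ 1 0 0) (qexp r u₀ (-1) 0 0)
      (qexp r u₀ 0 1 0) (qexp r u₀ 0 (-1) 0) (qexp r u₀ 0 0 1) g := by
  cases g <;> rfl

theorem algebraMap_fin_two (c : ℂ) :
    algebraMap ℂ (Matrix (Fin 2) (Fin 2) A) c = !![c • 1, 0; 0, c • 1] := by
  ext i j
  fin_cases i <;> fin_cases j <;>
    simp [Matrix.algebraMap_matrix_apply, Algebra.algebraMap_eq_smul_one]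

theorem torusMat_V0_sq (r k₁ u₀ u₁ : ℂ) (X X' Y Y' Z : A) :
    torusMat r k₁ u₀ u₁ X X' Y Y' Z .V0 ^ 2 = 0 := by
  rw [pow_two, torusMat]
  ext i j; fin_cases i <;> fin_cases j <;> simp

theorem torusMat_V1_quad (r : ℂ) {k₁ : ℂ} (hk₁ : k₁ ≠ 0) (u₀ u₁ : ℂ) (X X' Z : A) {Y Y' : A}
    (h1 : Y * Y' = 1) (h2 : Y' * Y = 1) :
    (torusMat r k₁ u₀ u₁ X X' Y Y' Z .V1 - algebraMap ℂ _ k₁) *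
      (torusMat r k₁ u₀ u₁ X X' Y Y' Z .V1 + algebraMap ℂ _ k₁⁻¹) = 0 := by
  have hI := I_mul_I
  rw [algebraMap_fin_two, algebraMap_fin_two, torusMat]
  ext i j
  fin_cases i <;> fin_cases j <;>
    simp [Algebra.algebraMap_eq_smul_one, mul_add, sub_mul, mul_sub, h1, h2,
      -map_sub, smul_smul] <;>
    match_scalars <;> grind

theorem torusMat_V1c_quad (r k₁ u₀ : ℂ) {u₁ : ℂ} (hu₁ : u₁ ≠ 0) {X X' : A} (Y Y' Z : A)
    (h1 : X * X' = 1) (h2 : X' * X = 1) :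
    (torusMat r k₁ u₀ u₁ X X' Y Y' Z .V1c - algebraMap ℂ _ u₁) *
      (torusMat r k₁ u₀ u₁ X X' Y Y' Z .V1c + algebraMap ℂ _ u₁⁻¹) = 0 := by
  have hI := I_mul_I
  rw [algebraMap_fin_two, algebraMap_fin_two, torusMat]
  ext i j
  fin_cases i <;> fin_cases j <;>
    simp [Algebra.algebraMap_eq_smul_one, mul_add, sub_mul, mul_sub, h1, h2,
      -map_sub, smul_smul] <;>
    match_scalars <;> grind

theorem torusMat_V0c_quad (r k₁ u₀ u₁ : ℂ) (X X' Y Y' Z : A) :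
    torusMat r k₁ u₀ u₁ X X' Y Y' Z .V0c ^ 2 +
      u₀⁻¹ • torusMat r k₁ u₀ u₁ X X' Y Y' Z .V0c = 0 := by
  rw [pow_two, torusMat]
  generalize r • (_ + _ : A) = s
  ext i j
  fin_cases i <;> fin_cases j <;>
    simp [Algebra.algebraMap_eq_smul_one]

theorem torusMat_prod_left {r : ℂ} (hr : r ≠ 0) (k₁ u₀ u₁ : ℂ)
    {X Y Z : A} (X' Y' : A) (h1 : X * (Y * Z) = (r⁻¹ * (I * u₀)⁻¹) • 1) :
    r • (torusMat r k₁ u₀ u₁ X X' Y Y' Z .V1c * torusMat r k₁ u₀ u₁ X X' Y Y' Z .V1 *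
      torusMat r k₁ u₀ u₁ X X' Y Y' Z .V0) =
      torusMat r k₁ u₀ u₁ X X' Y Y' Z .V0c + algebraMap ℂ _ u₀⁻¹ := by
  have hI := I_mul_I
  rw [algebraMap_fin_two, torusMat, torusMat, torusMat, torusMat, mul_assoc]
  ext i j
  fin_cases i <;> fin_cases j <;>
    simp [Algebra.algebraMap_eq_smul_one, sub_mul, mul_sub, h1, -map_sub,
      smul_smul, mul_assoc] <;>
    match_scalars <;> grind

theorem torusMat_prod_right {r : ℂ} (hr : r ≠ 0) (k₁ : ℂ) {u₀ : ℂ} (hu₀ : u₀ ≠ 0) (u₁ : ℂ)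
    {X X' Y Y' Z : A} (h1 : Z * (X * Y) = (r⁻¹ * (I * u₀)⁻¹) • 1)
    (h2 : X' * Y' = (I * u₀ * r⁻¹) • Z) :
    r • (torusMat r k₁ u₀ u₁ X X' Y Y' Z .V0c * torusMat r k₁ u₀ u₁ X X' Y Y' Z .V1c *
      torusMat r k₁ u₀ u₁ X X' Y Y' Z .V1) = torusMat r k₁ u₀ u₁ X X' Y Y' Z .V0 := by
  have hI := I_mul_I
  rw [torusMat, torusMat, torusMat, torusMat]
  ext i j
  fin_cases i <;> fin_cases j <;>
    simp [Algebra.algebraMap_eq_smul_one, add_mul, sub_mul, mul_sub, h1, h2, -map_sub,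
      smul_smul, mul_assoc] <;>
    match_scalars <;> grind

end Relations

/-! ### A representation of the torus and the transcendence of the image of `V̌₁ V₁` -/

section Representation

open LaurentPolynomial

/-- A power of the unit `T` clears the negative exponents. -/
theorem laurent_hom_injective {B : Type*} [Ring B] [Algebra ℂ B] (ψ : ℂ[T;T⁻¹] →ₐ[ℂ] B)
    (h : Function.Injective (Polynomial.aeval (R := ℂ) (ψ (T 1)))) : Function.Injective ψ := by
  rw [injective_iff_map_eq_zero]
  intro f hf
  obtain ⟨n, p, hp⟩ := exists_T_pow f
  have h1 : (ψ.comp Polynomial.toLaurentAlg) = Polynomial.aeval (ψ (T 1)) := by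
    ext; simp
  have h2 : Polynomial.aeval (ψ (T 1)) p = 0 := by
    rw [← h1, AlgHom.comp_apply, Polynomial.toLaurentAlg_apply, hp, map_mul, hf, zero_mul]
  rw [(map_eq_zero_iff _ h).mp h2, map_zero] at hp
  exact ((isUnit_T n).mul_left_eq_zero).mp hp.symm

/-- The action of `e^{v₀ S₁ + v₁ S₂ + v₂ S₃}` on functions on `ℤ`. -/
noncomputable def torusAction (r u₀ : ℂ) (v : Fin 3 → ℤ) : Module.End ℂ (ℤ → ℂ) where
  -- `e^{S₁+S₂+S₃}` must act by `(i u₀)⁻¹`, which leaves the exponents `v₀ - v₂` and `v₁ - v₂` of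
  -- `S₁` and `S₂`. These act by the shift `f(n - 1)` and by multiplication by `r^{2n}`; the
  -- remaining power of `r` is the symmetric ordering of the two.
  toFun f n := (Complex.I * u₀)⁻¹ ^ v 2 *
    r ^ (2 * (v 1 - v 2) * n - (v 0 - v 2) * (v 1 - v 2)) * f (n - (v 0 - v 2))
  map_add' f g := by ext n; simp only [Pi.add_apply]; ring
  map_smul' c f := by ext n; simp only [Pi.smul_apply, smul_eq_mul, RingHom.id_apply]; ring

theorem torusAction_apply (r u₀ : ℂ) (v : Fin 3 → ℤ) (f : ℤ → ℂ) (n : ℤ) :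
    torusAction r u₀ v f n = (Complex.I * u₀)⁻¹ ^ v 2 *
      r ^ (2 * (v 1 - v 2) * n - (v 0 - v 2) * (v 1 - v 2)) * f (n - (v 0 - v 2)) := rfl

theorem torusAction_zero (r u₀ : ℂ) : torusAction r u₀ 0 = 1 := by
  ext f n
  simp [torusAction_apply]

theorem torusAction_mul {r u₀ : ℂ} (hr : r ≠ 0) (hu₀ : u₀ ≠ 0) (v w : Fin 3 → ℤ) :
    torusAction r u₀ v * torusAction r u₀ w =
      r ^ (-shearForm v w) • torusAction r u₀ (v + w) := by
  ext f n
  simp only [Module.End.mul_apply, LinearMap.smul_apply, Pi.smul_apply, torusAction_apply,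
    Pi.add_apply, smul_eq_mul]
  rw [zpow_add₀ (inv_ne_zero (mul_ne_zero Complex.I_ne_zero hu₀)),
    show n - (v 0 - v 2) - (w 0 - w 2) = n - (v 0 + w 0 - (v 2 + w 2)) by ring]
  generalize f _ = y
  have h : r ^ (2 * (v 1 - v 2) * n - (v 0 - v 2) * (v 1 - v 2)) *
      r ^ (2 * (w 1 - w 2) * (n - (v 0 - v 2)) - (w 0 - w 2) * (w 1 - w 2)) =
      r ^ (-shearForm v w) * r ^ (2 * (v 1 + w 1 - (v 2 + w 2)) * n -
        (v 0 + w 0 - (v 2 + w 2)) * (v 1 + w 1 - (v 2 + w 2))) := by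
    rw [← zpow_add₀ hr, ← zpow_add₀ hr, shearForm]
    congr 1; ring
  linear_combination ((Complex.I * u₀)⁻¹ ^ v 2 * (Complex.I * u₀)⁻¹ ^ w 2 * y) * h

theorem torusAction_central (r u₀ : ℂ) :
    -Complex.I • torusAction r u₀ ![-1, -1, -1] = algebraMap ℂ _ u₀ := by
  ext f n
  simp [torusAction_apply]
  linear_combination (-u₀ * f n) * Complex.I_mul_I

/-- The representation of the quantum torus on functions on `ℤ`. -/
noncomputable def torusRep {r u₀ : ℂ} (hr : r ≠ 0) (hu₀ : u₀ ≠ 0) :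
    QTorus r u₀ →ₐ[ℂ] Module.End ℂ (ℤ → ℂ) :=
  RingQuot.liftAlgHom ℂ ⟨FreeAlgebra.lift ℂ (torusAction r u₀), by
    intro x y h
    cases h with
    | exp_zero => simp [torusAction_zero]
    | exp_mul v w => simp [torusAction_mul hr hu₀]
    | central => rw [map_smul, FreeAlgebra.lift_ι_apply, torusAction_central r u₀,
        AlgHom.commutes]⟩

theorem torusRep_qexp {r u₀ : ℂ} (hr : r ≠ 0) (hu₀ : u₀ ≠ 0) (a b c : ℤ) :
    torusRep hr hu₀ (qexp r u₀ a b c) = torusAction r u₀ ![a, b, c] := by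
  simp [torusRep, qexp]

/-- The induced action of matrices over the quantum torus. -/
noncomputable def matTorusRep {r u₀ : ℂ} (hr : r ≠ 0) (hu₀ : u₀ ≠ 0) :
    Matrix (Fin 2) (Fin 2) (QTorus r u₀) →ₐ[ℂ] Module.End ℂ (Fin 2 → ℤ → ℂ) :=
  (endVecAlgEquivMatrixEnd (Fin 2) ℂ ℂ (ℤ → ℂ)).symm.toAlgHom.comp (torusRep hr hu₀).mapMatrix

theorem matTorusRep_apply {r u₀ : ℂ} (hr : r ≠ 0) (hu₀ : u₀ ≠ 0)
    (M : Matrix (Fin 2) (Fin 2) (QTorus r u₀)) (v : Fin 2 → ℤ → ℂ) (i : Fin 2) :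
    matTorusRep hr hu₀ M v i =
      torusRep hr hu₀ (M i 0) (v 0) + torusRep hr hu₀ (M i 1) (v 1) := by
  exact Fin.sum_univ_two fun j => torusRep hr hu₀ (M i j) (v j)

theorem matTorusRep_V1_apply {r u₀ : ℂ} (hr : r ≠ 0) (hu₀ : u₀ ≠ 0) (k₁ u₁ : ℂ)
    (v : Fin 2 → ℤ → ℂ) (n : ℤ) :
    matTorusRep hr hu₀ (matIII r k₁ u₀ u₁ .V1) v 0 n =
        (k₁ - k₁⁻¹) * (v 0 n + v 1 n) - Complex.I * (r ^ (2 * n) * (v 0 n + v 1 n)) -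
          Complex.I * (r ^ (-(2 * n)) * v 1 n) ∧
      matTorusRep hr hu₀ (matIII r k₁ u₀ u₁ .V1) v 1 n =
        Complex.I * (r ^ (2 * n) * (v 0 n + v 1 n)) := by
  constructor <;> simp [matTorusRep_apply, matIII, torusRep_qexp, torusAction_apply]
  all_goals ring

theorem matTorusRep_V1c_apply {r u₀ : ℂ} (hr : r ≠ 0) (hu₀ : u₀ ≠ 0) (k₁ u₁ : ℂ)
    (v : Fin 2 → ℤ → ℂ) (n : ℤ) :
    matTorusRep hr hu₀ (matIII r k₁ u₀ u₁ .V1c) v 0 n = -(Complex.I * v 1 (n - 1)) ∧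
      matTorusRep hr hu₀ (matIII r k₁ u₀ u₁ .V1c) v 1 n =
        Complex.I * v 0 (n + 1) + (u₁ - u₁⁻¹) * v 1 n := by
  constructor <;> simp [matTorusRep_apply, matIII, torusRep_qexp, torusAction_apply]
  ring

theorem aeval_V1c_mul_V1_injective {r u₀ : ℂ} (hr : r ≠ 0) (hu₀ : u₀ ≠ 0) (k₁ u₁ : ℂ) :
    Function.Injective (Polynomial.aeval (R := ℂ)
      (matIII r k₁ u₀ u₁ .V1c * matIII r k₁ u₀ u₁ .V1)) := by
  set W := matTorusRep hr hu₀ (matIII r k₁ u₀ u₁ .V1c * matIII r k₁ u₀ u₁ .V1) with hW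
  set v : Fin 2 → ℤ → ℂ := ![Pi.single 0 1, 0] with hv
  -- The first component of `W^m v` has its top at `m`. The second must vanish already at `m`, not
  -- only beyond it, so that it cannot cancel the top coefficient at the next step.
  have htop : ∀ m : ℕ, (W ^ m) v 0 m ≠ 0 ∧ (∀ n : ℤ, m < n → (W ^ m) v 0 n = 0) ∧
      ∀ n : ℤ, m ≤ n → (W ^ m) v 1 n = 0 := by
    intro m
    induction m with
    | zero =>
      refine ⟨by simp [hv], fun n hn => ?_, fun n _ => by simp [hv]⟩
      have : n ≠ 0 := by rintro rfl; simp at hn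
      simp [hv, this]
    | succ m ih =>
      obtain ⟨h1, h2, h3⟩ := ih
      rw [pow_succ', Module.End.mul_apply]
      generalize (W ^ m) v = y at *
      have e0 : ∀ n, W y 0 n = r ^ (2 * (n - 1)) * (y 0 (n - 1) + y 1 (n - 1)) := by
        intro n
        rw [hW, map_mul, Module.End.mul_apply, (matTorusRep_V1c_apply hr hu₀ k₁ u₁ _ n).1,
          (matTorusRep_V1_apply hr hu₀ k₁ u₁ _ _).2]
        linear_combination (-(r ^ (2 * (n - 1)) * (y 0 (n - 1) + y 1 (n - 1)))) * Complex.I_mul_I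
      refine ⟨?_, fun n hn => ?_, fun n hn => ?_⟩
      · rw [e0, show ((m + 1 : ℕ) : ℤ) - 1 = m by push_cast; ring, h3 m le_rfl, add_zero]
        exact mul_ne_zero (zpow_ne_zero _ hr) h1
      · push_cast at hn
        rw [e0, h2 _ (by omega), h3 _ (by omega)]; simp
      · push_cast at hn
        rw [hW, map_mul, Module.End.mul_apply, (matTorusRep_V1c_apply hr hu₀ k₁ u₁ _ n).2,
          (matTorusRep_V1_apply hr hu₀ k₁ u₁ _ _).1, (matTorusRep_V1_apply hr hu₀ k₁ u₁ _ _).2,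
          h2 _ (by omega), h2 _ (by omega), h3 _ (by omega), h3 _ (by omega)]
        simp
  rw [injective_iff_map_eq_zero]
  intro p hp
  by_contra hp0
  have h1 : Polynomial.aeval W p = 0 := by
    rw [hW, Polynomial.aeval_algHom_apply, hp, map_zero]
  -- At this point of `ℤ` only the leading term of `p` contributes.
  have h2 : (Polynomial.aeval W p) v 0 p.natDegree = 0 := by rw [h1]; rfl
  rw [Polynomial.aeval_eq_sum_range, LinearMap.sum_apply, Finset.sum_apply, Finset.sum_apply,
    Finset.sum_range_succ, Finset.sum_eq_zero, zero_add] at h2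
  · exact mul_ne_zero (Polynomial.leadingCoeff_ne_zero.mpr hp0) (htop _).1 h2
  · intro i hi
    have := (htop i).2.1 p.natDegree (by simpa using hi)
    simp [this]

end Representation

/-! ### Bernstein relations from the presentation -/

section Presentation

open LaurentPolynomial

variable {A : Type*} [Ring A] [Algebra ℂ A]

theorem mul_self_of_quadratic {k : ℂ} (hk : k ≠ 0) {b : A}
    (h : (b - algebraMap ℂ A k) * (b + algebraMap ℂ A k⁻¹) = 0) :
    b * b = (k - k⁻¹) • b + (1 : ℂ) • 1 := by
  have h1 : (b - algebraMap ℂ A k) * (b + algebraMap ℂ A k⁻¹) =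
      b * b - (k - k⁻¹) • b - (k * k⁻¹) • 1 := by
    simp only [Algebra.algebraMap_eq_smul_one, sub_mul, mul_add, mul_smul_comm, smul_mul_assoc,
      mul_one, one_mul]
    module
  rw [h1, mul_inv_cancel₀ hk, sub_sub] at h
  exact sub_eq_zero.mp h

/-- The unit with inverse `b - (k - k⁻¹)` attached to a solution `b` of a Hecke relation. -/
noncomputable def heckeUnit {K : ℂ} {b : A} (h : b * b = K • b + (1 : ℂ) • 1) : Aˣ where
  val := b
  inv := b - K • 1
  val_inv := by rw [mul_sub, h, mul_smul_comm, mul_one]; simp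
  inv_val := by rw [sub_mul, h, smul_mul_assoc, one_mul]; simp

theorem flipHom_one_T_one : flipHom 1 (T 1) = T (-1) := by
  rw [flipHom_T]; simp

theorem disc_ne_zero (K U : ℂ) :
    (C K * T 1 + C U) * flipHom 1 (C K * T 1 + C U) -
      (1 : ℂ) • (flipHom 1 (T 1) - T 1) ^ 2 ≠ 0 := by
  intro h
  have h2 : (C K * T 1 + C U) * flipHom 1 (C K * T 1 + C U) -
      (1 : ℂ) • (flipHom 1 (T 1) - T 1) ^ 2 =
      (-1 : ℂ) • T 2 + (K * U) • T 1 + (K * K + U * U + 2) • T 0 + (K * U) • T (-1) +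
        (-1 : ℂ) • T (-2) := by
    have e1 : (T 1 * T (-1) : ℂ[T;T⁻¹]) = 1 := by rw [← T_add]; simp
    have e2 : (T 2 : ℂ[T;T⁻¹]) = T 1 * T 1 := by rw [← T_add]; norm_num
    have e3 : (T (-2) : ℂ[T;T⁻¹]) = T (-1) * T (-1) := by rw [← T_add]; norm_num
    simp only [map_add, map_mul, flipHom_C, flipHom_one_T_one, smul_eq_C_mul, e2, e3, map_neg,
      map_one, map_ofNat, T_zero]
    linear_combination (C K * C K + 2) * e1
  rw [h2] at h
  -- The coefficient of `T²` is `-1` whatever `K` and `U` are.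
  have h3 := congrArg (fun f : ℂ[T;T⁻¹] => f.coeff 2) h
  simp [-T_zero] at h3

theorem heckeTwist_b {b : A} {K U : ℂ} (hb : b * b = K • b + (1 : ℂ) • 1) {c : A}
    (hc : c * c = U • c + (1 : ℂ) • 1) :
    HeckeTwist (laurentEval (heckeUnit hc * heckeUnit hb)) 1 (C K * T 1 + C U) K 1 b where
  mul_T := by
    rw [flipHom_one_T_one, map_add, map_C_mul_T, laurentEval_T, laurentEval_T,
      C_eq_algebraMap, AlgHom.commutes, Algebra.algebraMap_eq_smul_one, zpow_one, zpow_neg_one,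
      mul_inv_rev]
    -- Here `w = c b` and `w⁻¹ = (b - K)(c - U)`.
    change b * (c * b) = (b - K • 1) * (c - U • 1) * b + (K • (c * b) + U • 1)
    have h : (b - K • 1) * (c - U • 1) * b =
        b * (c * b) - U • (b * b) - K • (c * b) + (K * U) • b := by
      simp only [sub_mul, mul_sub, smul_mul_assoc, mul_smul_comm, one_mul, mul_one, mul_assoc]
      module
    rw [h, hb]
    module
  sq := hb
  flip_g := by
    rw [map_add, map_mul, flipHom_C, flipHom_C, flipHom_one_T_one, smul_eq_C_mul]
    ring
  disc_ne_zero := disc_ne_zero K U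

/-- Eliminating `d` between the two product relations gives `a = q w a w - r u₀⁻¹ w`. Multiplying by
`w⁻¹` on the left and solving for `a w` gives the twist. -/
theorem heckeTwist_a {r u₀ : ℂ} (hr : r ≠ 0) (hu₀ : u₀ ≠ 0) {q : ℂˣ} (hq : r ^ 2 = q)
    {a d : A} (w : Aˣ) (ha : a * a = 0) (hd : r • (w * a) = d + algebraMap ℂ A u₀⁻¹)
    (ha' : r • (d * w) = a) :
    HeckeTwist (laurentEval w) q⁻¹ (C (r⁻¹ * u₀⁻¹)) 0 0 a where
  mul_T := by
    have h1 : a = (r * r) • (w * (a * w)) - (r * u₀⁻¹) • (w : A) := by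
      conv_lhs => rw [← ha', eq_sub_of_add_eq hd.symm]
      simp only [Algebra.algebraMap_eq_smul_one, sub_mul, smul_mul_assoc, one_mul, smul_sub,
        smul_smul, mul_assoc]
    have h2 : ((w⁻¹ : Aˣ) : A) * a = (r * r) • (a * w) - (r * u₀⁻¹) • 1 := by
      conv_lhs => rw [h1]
      rw [mul_sub, mul_smul_comm, mul_smul_comm, Units.inv_mul, ← mul_assoc, Units.inv_mul,
        one_mul]
    rw [flipHom_T, map_C_mul_T, laurentEval_T, laurentEval_T, C_eq_algebraMap, AlgHom.commutes,
      Algebra.algebraMap_eq_smul_one, zpow_one, zpow_neg_one, smul_mul_assoc, h2, smul_sub,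
      smul_smul, smul_smul, zpow_one, Units.val_inv_eq_inv_val, ← hq]
    match_scalars <;> field_simp <;> simp
  sq := by simp [ha]
  flip_g := by rw [flipHom_C]; simp
  disc_ne_zero := by
    rw [flipHom_C, zero_smul, sub_zero, ← map_mul, C_eq_algebraMap,
      map_ne_zero_iff _ (FaithfulSMul.algebraMap_injective _ _)]
    exact mul_ne_zero (mul_ne_zero (inv_ne_zero hr) (inv_ne_zero hu₀))
      (mul_ne_zero (inv_ne_zero hr) (inv_ne_zero hu₀))

/-- The letters `c` and `d` reduce to the other two: `c = w (b - K)`, because `b - K` inverts `b`,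
and `d = r w a - u₀⁻¹`. -/
theorem exists_inZigzagSpan_mul_gen {r u₀ : ℂ} {K U : ℂ} {a b c d : A} {q : ℂˣ}
    {ga gb : ℂ[T;T⁻¹]} {αa βa αb βb : ℂ}
    (hb : b * b = K • b + (1 : ℂ) • 1) (hc : c * c = U • c + (1 : ℂ) • 1)
    (hd : r • (c * b * a) = d + algebraMap ℂ A u₀⁻¹)
    (hta : HeckeTwist (laurentEval (heckeUnit hc * heckeUnit hb)) q⁻¹ ga αa βa a)
    (htb : HeckeTwist (laurentEval (heckeUnit hc * heckeUnit hb)) 1 gb αb βb b)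
    {y : A} {N : ℕ} (hy : InZigzagSpan (laurentEval (heckeUnit hc * heckeUnit hb)) a b N y) :
    InZigzagSpan (laurentEval (heckeUnit hc * heckeUnit hb)) a b (N + 1) (a * y) ∧
    InZigzagSpan (laurentEval (heckeUnit hc * heckeUnit hb)) a b (N + 1) (b * y) ∧
    InZigzagSpan (laurentEval (heckeUnit hc * heckeUnit hb)) a b (N + 1) (c * y) ∧
    InZigzagSpan (laurentEval (heckeUnit hc * heckeUnit hb)) a b (N + 1) (d * y) := by
  have hT : laurentEval (heckeUnit hc * heckeUnit hb) (T 1) = c * b := by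
    rw [laurentEval_T, zpow_one]; rfl
  have hcy : c * y = c * b * (b * y + (-K) • y) := by
    have h : b * (b * y) = K • (b * y) + y := by rw [← mul_assoc, hb]; simp [add_mul]
    rw [mul_assoc, mul_add, h, mul_smul_comm]; congr 1; module
  have hdy : d * y = r • (c * b * (a * y)) + (-u₀⁻¹) • y := by
    rw [eq_sub_of_add_eq hd.symm, sub_mul, smul_mul_assoc, ← Algebra.smul_def, mul_assoc (c * b)]
    module
  refine ⟨hy.mul_a hta, hy.mul_b htb, ?_, ?_⟩
  · rw [hcy, ← hT]
    exact ((hy.mul_b htb).add ((hy.mono (Nat.le_succ N)).smul _)).mul_left _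
  · rw [hdy, ← hT]
    exact (((hy.mul_a hta).mul_left _).smul _).add ((hy.mono (Nat.le_succ N)).smul _)

end Presentation

/-! ### The relations in `H_III` and induction on left multiplication -/

section CherednikAlgebra

variable (r k₁ u₀ u₁ : ℂ)

theorem HIII.gen_V0_sq : HIII.gen r k₁ u₀ u₁ .V0 * HIII.gen r k₁ u₀ u₁ .V0 = 0 := by
  have h := RingQuot.mkAlgHom_rel ℂ (HIIIRel.sq_V0 (r := r) (k₁ := k₁) (u₀ := u₀) (u₁ := u₁))
  rwa [pow_two, map_mul, map_zero] at h

theorem HIII.gen_V1_quad : (HIII.gen r k₁ u₀ u₁ .V1 - algebraMap ℂ _ k₁) *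
    (HIII.gen r k₁ u₀ u₁ .V1 + algebraMap ℂ _ k₁⁻¹) = 0 := by
  have h := RingQuot.mkAlgHom_rel ℂ (HIIIRel.quad_V1 (r := r) (k₁ := k₁) (u₀ := u₀) (u₁ := u₁))
  rwa [map_mul, map_sub, map_add, map_zero, AlgHom.commutes, AlgHom.commutes] at h

theorem HIII.gen_V1c_quad : (HIII.gen r k₁ u₀ u₁ .V1c - algebraMap ℂ _ u₁) *
    (HIII.gen r k₁ u₀ u₁ .V1c + algebraMap ℂ _ u₁⁻¹) = 0 := by
  have h := RingQuot.mkAlgHom_rel ℂ (HIIIRel.quad_V1c (r := r) (k₁ := k₁) (u₀ := u₀) (u₁ := u₁))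
  rwa [map_mul, map_sub, map_add, map_zero, AlgHom.commutes, AlgHom.commutes] at h

theorem HIII.gen_prod_left :
    r • (HIII.gen r k₁ u₀ u₁ .V1c * HIII.gen r k₁ u₀ u₁ .V1 * HIII.gen r k₁ u₀ u₁ .V0) =
      HIII.gen r k₁ u₀ u₁ .V0c + algebraMap ℂ _ u₀⁻¹ := by
  have h := RingQuot.mkAlgHom_rel ℂ (HIIIRel.prod_left (r := r) (k₁ := k₁) (u₀ := u₀) (u₁ := u₁))
  rwa [map_smul, map_mul, map_mul, map_add, AlgHom.commutes] at h

theorem HIII.gen_prod_right :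
    r • (HIII.gen r k₁ u₀ u₁ .V0c * (HIII.gen r k₁ u₀ u₁ .V1c * HIII.gen r k₁ u₀ u₁ .V1)) =
      HIII.gen r k₁ u₀ u₁ .V0 := by
  have h := RingQuot.mkAlgHom_rel ℂ (HIIIRel.prod_right (r := r) (k₁ := k₁) (u₀ := u₀) (u₁ := u₁))
  rwa [map_smul, map_mul, map_mul, mul_assoc] at h

/-- Left multiplication by all elements preserves any additive property that is preserved by left
multiplication by scalars and generators. -/
theorem HIII.mul_induction {P : HIII r k₁ u₀ u₁ → Prop}
    (hadd : ∀ y z, P y → P z → P (y + z)) (hsmul : ∀ (c : ℂ) y, P y → P (c • y))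
    (hgen : ∀ g y, P y → P (HIII.gen r k₁ u₀ u₁ g * y)) (x : HIII r k₁ u₀ u₁) :
    ∀ y, P y → P (x * y) := by
  obtain ⟨x, rfl⟩ := RingQuot.mkAlgHom_surjective ℂ (HIIIRel r k₁ u₀ u₁) x
  induction x using FreeAlgebra.induction with
  | grade0 c =>
    intro y hy
    rw [AlgHom.commutes, ← Algebra.smul_def]
    exact hsmul c y hy
  | grade1 g => exact hgen g
  | mul x₁ x₂ h₁ h₂ =>
    intro y hy
    rw [map_mul, mul_assoc]
    exact h₁ _ (h₂ _ hy)
  | add x₁ x₂ h₁ h₂ =>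
    intro y hy
    rw [map_add, add_mul]
    exact hadd _ _ (h₁ _ hy) (h₂ _ hy)

end CherednikAlgebra

/-! ### The embedding theorem -/

theorem mainTheorem4 (q r k₁ u₀ u₁ : ℂ) (hr : r ^ 2 = q) (hq₀ : q ≠ 0)
    (hq : ∀ m : ℕ, 0 < m → q ^ m ≠ 1) (hk₁ : k₁ ≠ 0) (hu₀ : u₀ ≠ 0) (hu₁ : u₁ ≠ 0) :
    (matIII r k₁ u₀ u₁ .V0 ^ 2 = 0 ∧
      (matIII r k₁ u₀ u₁ .V1 - algebraMap ℂ _ k₁) *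
        (matIII r k₁ u₀ u₁ .V1 + algebraMap ℂ _ k₁⁻¹) = 0 ∧
      matIII r k₁ u₀ u₁ .V0c ^ 2 + u₀⁻¹ • matIII r k₁ u₀ u₁ .V0c = 0 ∧
      (matIII r k₁ u₀ u₁ .V1c - algebraMap ℂ _ u₁) *
        (matIII r k₁ u₀ u₁ .V1c + algebraMap ℂ _ u₁⁻¹) = 0 ∧
      r • (matIII r k₁ u₀ u₁ .V1c * matIII r k₁ u₀ u₁ .V1 * matIII r k₁ u₀ u₁ .V0) =
        matIII r k₁ u₀ u₁ .V0c + algebraMap ℂ _ u₀⁻¹ ∧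
      r • (matIII r k₁ u₀ u₁ .V0c * matIII r k₁ u₀ u₁ .V1c * matIII r k₁ u₀ u₁ .V1) =
        matIII r k₁ u₀ u₁ .V0) ∧
    ∃ φ : HIII r k₁ u₀ u₁ →ₐ[ℂ] Matrix (Fin 2) (Fin 2) (QTorus r u₀),
      (∀ g : HIIIGen, φ (HIII.gen r k₁ u₀ u₁ g) = matIII r k₁ u₀ u₁ g) ∧
      Function.Injective φ := by
  have hr0 : r ≠ 0 := by
    rintro rfl
    exact hq₀ (by rw [← hr]; simp)
  have hrel : matIII r k₁ u₀ u₁ .V0 ^ 2 = 0 ∧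
      (matIII r k₁ u₀ u₁ .V1 - algebraMap ℂ _ k₁) *
        (matIII r k₁ u₀ u₁ .V1 + algebraMap ℂ _ k₁⁻¹) = 0 ∧
      matIII r k₁ u₀ u₁ .V0c ^ 2 + u₀⁻¹ • matIII r k₁ u₀ u₁ .V0c = 0 ∧
      (matIII r k₁ u₀ u₁ .V1c - algebraMap ℂ _ u₁) *
        (matIII r k₁ u₀ u₁ .V1c + algebraMap ℂ _ u₁⁻¹) = 0 ∧
      r • (matIII r k₁ u₀ u₁ .V1c * matIII r k₁ u₀ u₁ .V1 * matIII r k₁ u₀ u₁ .V0) =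
        matIII r k₁ u₀ u₁ .V0c + algebraMap ℂ _ u₀⁻¹ ∧
      r • (matIII r k₁ u₀ u₁ .V0c * matIII r k₁ u₀ u₁ .V1c * matIII r k₁ u₀ u₁ .V1) =
        matIII r k₁ u₀ u₁ .V0 := by
    simp only [matIII_eq_torusMat]
    exact ⟨torusMat_V0_sq _ _ _ _ _ _ _ _ _,
      torusMat_V1_quad _ hk₁ _ _ _ _ _ (qexp_zero_one_mul_neg r u₀) (qexp_zero_neg_mul_one r u₀),
      torusMat_V0c_quad _ _ _ _ _ _ _ _ _,
      torusMat_V1c_quad _ _ _ hu₁ _ _ _ (qexp_one_zero_mul_neg r u₀) (qexp_neg_mul_one_zero r u₀),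
      torusMat_prod_left hr0 _ _ _ _ _ (qexp_mul_three r hu₀),
      torusMat_prod_right hr0 _ hu₀ _ (qexp_mul_three' r hu₀) (qexp_neg_mul_neg r u₀)⟩
  refine ⟨hrel, ?_⟩
  obtain ⟨h1, h2, h3, h4, h5, h6⟩ := hrel
  let φ : HIII r k₁ u₀ u₁ →ₐ[ℂ] Matrix (Fin 2) (Fin 2) (QTorus r u₀) :=
    RingQuot.liftAlgHom ℂ ⟨FreeAlgebra.lift ℂ (matIII r k₁ u₀ u₁), by
      intro x y h
      cases h <;>
        simpa only [map_mul, map_pow, map_add, map_sub, map_smul, map_zero, AlgHom.commutes,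
          FreeAlgebra.lift_ι_apply]⟩
  have hφ : ∀ g : HIIIGen, φ (HIII.gen r k₁ u₀ u₁ g) = matIII r k₁ u₀ u₁ g := by
    intro g
    simp only [φ, HIII.gen, RingQuot.liftAlgHom_mkAlgHom_apply, FreeAlgebra.lift_ι_apply]
  refine ⟨φ, hφ, ?_⟩
  have hb := mul_self_of_quadratic hk₁ (HIII.gen_V1_quad r k₁ u₀ u₁)
  have hc := mul_self_of_quadratic hu₁ (HIII.gen_V1c_quad r k₁ u₀ u₁)
  have htb := heckeTwist_b hb hc
  have hta := heckeTwist_a (q := Units.mk0 q hq₀) hr0 hu₀ hr (heckeUnit hc * heckeUnit hb)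
    (HIII.gen_V0_sq r k₁ u₀ u₁) (HIII.gen_prod_left r k₁ u₀ u₁) (HIII.gen_prod_right r k₁ u₀ u₁)
  refine injective_of_zigzagSpan hq hta htb (fun y => ?_) φ (laurent_hom_injective _ ?_)
  -- Spanning: the empty word `1` is in the span, and left multiplication by each generator
  -- preserves membership.
  · rw [← mul_one y]
    refine HIII.mul_induction r k₁ u₀ u₁
      (P := fun y => ∃ N, InZigzagSpan (laurentEval (heckeUnit hc * heckeUnit hb))
        (HIII.gen r k₁ u₀ u₁ .V0) (HIII.gen r k₁ u₀ u₁ .V1) N y) ?_ ?_ ?_ y 1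
      ⟨0, InZigzagSpan.zigzag_mem (n := 0) (by simp)⟩
    · rintro y z ⟨N, hy⟩ ⟨M, hz⟩
      exact ⟨max N M, (hy.mono (le_max_left _ _)).add (hz.mono (le_max_right _ _))⟩
    · rintro c y ⟨N, hy⟩
      exact ⟨N, hy.smul c⟩
    · rintro g y ⟨N, hy⟩
      obtain ⟨ha', hb', hc', hd'⟩ :=
        exists_inZigzagSpan_mul_gen hb hc (HIII.gen_prod_left r k₁ u₀ u₁) hta htb hy
      cases g
      -- The constructors come in the order `V0, V1, V0c, V1c`, so `d` precedes `c`.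
      exacts [⟨_, ha'⟩, ⟨_, hb'⟩, ⟨_, hd'⟩, ⟨_, hc'⟩]
  · rw [AlgHom.comp_apply, laurentEval_T, zpow_one]
    change Function.Injective (Polynomial.aeval
      (φ (HIII.gen r k₁ u₀ u₁ .V1c * HIII.gen r k₁ u₀ u₁ .V1)))
    rw [map_mul, hφ, hφ]
    exact aeval_V1c_mul_V1_injective hr0 hu₀ k₁ u₁
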